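/- Let $(R,S_R)$ be a right-angled Coxeter system with Coxeter matrix $m$ (so $m(s,t)\in\{1,2,\infty\}$ for all $s,t\in S_R$; $S_R$ may be infinite), and let $R^A$ be the right-angled Artin group of the same type, i.e. the group generated by $S_R$ with relations $st=ts$ whenever $m(s,t)=2$. Let $A=\mathbb{Z}[q^{-1},q]$ and let $\mathcal{H}(R)$ be the Hecke algebra of $(R,S_R)$: the free $A$-module with basis $(T_w)_{w\in R}$ and product determined by $T_wT_s=T_{ws}$ if $\ell(ws)>\ell(w)$ and $T_wT_s=qT_{ws}+(q-1)T_w$ otherwise ($w\in R$, $s\in S_R$). Let $\mathcal{H}^*(R)$ be its group of invertible elements. Then there is a (unique) group morphism $\phi:R^A\to\mathcal{H}^*(R)$ with $\phi(s)=T_s$ for all $s\in S_R$, and $\phi$ is injective. Moreover, let $V_R$ be the free $\mathbb{Z}$-module on the set $R$ and, for $s\in S_R$, let $P^s\in\mathrm{End}(V_R)$ be the linear extension of the map $R\to R$ sending $w$ to $ws$ if $\ell(ws)<\ell(w)$ and to $w$ otherwise. For $x\in\{-1,q\}$ define $f^x(s)\in\mathrm{End}_A(A\otimes_{\mathbb{Z}}V_R)$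 by $$f^{q}(s)=q\,\mathrm{Id}-(q+1)P^s,\qquad f^{-1}(s)=-\mathrm{Id}+(q+1)P^s .$$ Then for each $x\in\{-1,q\}$ there is a (unique) $A$-algebra morphism $\sigma^{x,R}:\mathcal{H}(R)\to\mathrm{End}_A(A\otimes_{\mathbb{Z}}V_R)$ with $\sigma^{x,R}(T_s)=f^x(s)$ for all $s\in S_R$, and for every $t\in\mathbb{Q}\setminus\{-1,0,1\}$ specializing $\sigma^{x,R}\circ\phi$ at $q=t$ gives a faithful representation $$\Sigma^{x,t}:R^A\to\mathrm{Aut}_{\mathbb{Q}}(\mathbb{Q}\otimes_{\mathbb{Z}}V_R);$$ that is, $\Sigma^{x,t}$ is an injective group morphism and $\Sigma^{x,t}(g)(\mathrm{sp}_t(v))=\mathrm{sp}_t\big(\sigma^{x,R}(\phi(g))(v)\big)$ for all $g\in R^A$ and $v\in A\otimes_{\mathbb{Z}}V_R$, where $\mathrm{sp}_t:A\otimes_{\mathbb{Z}}V_R\to\mathbb{Q}\otimes_{\mathbb{Z}}V_R$ is $a\otimes v\mapsto a(t)\otimes v$. -/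

import Mathlib

open scoped TensorProduct

noncomputable section

/-! ### Right-angled Coxeter systems and Artin groups

In a `CoxeterMatrix` the entry `0` stands for `∞`. -/

/-- A Coxeter matrix is right-angled if all its entries lie in `{1, 2, ∞}`. -/
def CoxeterMatrix.IsRightAngled {B : Type*} (M : CoxeterMatrix B) : Prop :=
  ∀ i j : B, M i j = 1 ∨ M i j = 2 ∨ M i j = 0

/-- The relator `lhs * rhs⁻¹` of the braid relation of the generators `s`, `t`:
`(st)^(m/2) = (ts)^(m/2)` for even `m = m(s,t)` and
`t (st)^((m-1)/2) = s (ts)^((m-1)/2)` for odd `m`.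
For `m = ∞` (the entry `0`) the relator is trivial, i.e. there is no relation. -/
def CoxeterMatrix.artinRelator {B : Type*} (M : CoxeterMatrix B) (i j : B) : FreeGroup B :=
  let s := FreeGroup.of i
  let t := FreeGroup.of j
  if Even (M i j) then (s * t) ^ (M i j / 2) * ((t * s) ^ (M i j / 2))⁻¹
  else (t * (s * t) ^ ((M i j - 1) / 2)) * (s * (t * s) ^ ((M i j - 1) / 2))⁻¹

/-- The Artin group whose type is the Coxeter matrix `M`. -/
abbrev ArtinGroup {B : Type*} (M : CoxeterMatrix B) : Type _ :=
  PresentedGroup {r : FreeGroup B | ∃ i j, r = M.artinRelator i j}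

/-- The standard generators of the Artin group. -/
def ArtinGroup.gen {B : Type*} (M : CoxeterMatrix B) (i : B) : ArtinGroup M :=
  PresentedGroup.of i

/-! ### A parity cocycle on a Coxeter group

It is only needed for the associativity of the product of the Hecke algebra. -/

namespace CoxeterSystem

variable {B W : Type*} [Group W] {M : CoxeterMatrix B} (cs : CoxeterSystem M W)

open Classical in
/-- The map `(x, ε) ↦ (s x s, ε + [x = s])` for a generator `s`. -/
def parityStep (i : B) : Function.End (W × ZMod 2) := fun p =>
  (cs.simple i * p.1 * cs.simple i, p.2 + if p.1 = cs.simple i then 1 else 0)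

open Classical in
theorem parityStep_pow (i j : B) (n : ℕ) (x : W) (e : ZMod 2) :
    ((cs.parityStep i * cs.parityStep j) ^ n : Function.End (W × ZMod 2)) (x, e) =
      ((cs.simple i * cs.simple j) ^ n * x * ((cs.simple i * cs.simple j) ^ n)⁻¹,
        e + ∑ l ∈ Finset.range (2 * n),
          if x = ((cs.simple i * cs.simple j) ^ l)⁻¹ * cs.simple j then 1 else 0) := by
  set s := cs.simple i with hs
  set t := cs.simple j with ht
  have hss : s * s = 1 := cs.simple_mul_simple_self i
  have htt : t * t = 1 := cs.simple_mul_simple_self j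
  have hsi : s⁻¹ = s := cs.inv_simple i
  have hti : t⁻¹ = t := cs.inv_simple j
  have hconj : ∀ k : ℕ, t * (s * t) ^ k = ((s * t) ^ k)⁻¹ * t := by
    intro k
    have h1 : t * (s * t) * t⁻¹ = (s * t)⁻¹ := by
      simp [hti, hsi, mul_assoc, htt]
    have h2 : t * (s * t) ^ k * t⁻¹ = ((s * t) ^ k)⁻¹ := by
      rw [← conj_pow, h1, inv_pow]
    rw [← h2]; group
  induction n with
  | zero => simp; rfl
  | succ n ih =>
    rw [pow_succ']
    change (cs.parityStep i) ((cs.parityStep j)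
      (((cs.parityStep i * cs.parityStep j) ^ n : Function.End (W × ZMod 2)) (x, e))) = _
    rw [ih, show 2 * (n + 1) = 2 * n + 1 + 1 by ring, Finset.sum_range_succ,
      Finset.sum_range_succ]
    simp only [parityStep, ← hs, ← ht]
    have e1 : ((s * t) ^ n * x * ((s * t) ^ n)⁻¹ = t) ↔ x = ((s * t) ^ (2 * n))⁻¹ * t := by
      rw [mul_inv_eq_iff_eq_mul, ← eq_inv_mul_iff_mul_eq, hconj, ← mul_assoc, ← mul_inv_rev,
        ← pow_add, two_mul]
    have e2 : (t * ((s * t) ^ n * x * ((s * t) ^ n)⁻¹) * t = s) ↔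
        x = ((s * t) ^ (2 * n + 1))⁻¹ * t := by
      have : (t * ((s * t) ^ n * x * ((s * t) ^ n)⁻¹) * t = s) ↔
          (s * t) ^ n * x * ((s * t) ^ n)⁻¹ = (s * t)⁻¹ * t := by
        generalize (s * t) ^ n * x * ((s * t) ^ n)⁻¹ = y
        rw [← eq_mul_inv_iff_mul_eq, ← eq_inv_mul_iff_mul_eq, mul_inv_rev, hti, hsi, mul_assoc]
      rw [this, mul_inv_eq_iff_eq_mul, ← eq_inv_mul_iff_mul_eq, mul_assoc, hconj, ← mul_assoc,
        ← mul_assoc, ← mul_inv_rev, ← mul_inv_rev, ← pow_succ', ← pow_add]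
      rw [show n + (n + 1) = 2 * n + 1 by ring]
    simp only [e1, e2]
    refine Prod.ext ?_ ?_
    · simp [pow_succ', hsi, hti, mul_assoc]
    · simp only [add_assoc]

theorem parityStep_isLiftable : M.IsLiftable cs.parityStep := by
  classical
  intro i j
  funext ⟨x, e⟩
  rw [parityStep_pow, cs.simple_mul_simple_pow, two_mul, Finset.sum_range_add]
  simp only [pow_add, cs.simple_mul_simple_pow, one_mul, CharTwo.add_self_eq_zero]
  simp; rfl

/-- The action of the Coxeter group extending `parityStep`. -/
def parityHom : W →* Function.End (W × ZMod 2) :=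
  cs.lift ⟨cs.parityStep, cs.parityStep_isLiftable⟩

/-- The parity of the number of occurrences of `x` among the right inversions of a word for `w`. -/
def parity (w x : W) : ZMod 2 := (cs.parityHom w (x, 0)).2

theorem parityHom_apply (w x : W) (e : ZMod 2) :
    cs.parityHom w (x, e) = (w * x * w⁻¹, cs.parity w x + e) := by
  classical
  induction w using cs.simple_induction_left generalizing x e with
  | one =>
    rw [parity, map_one]
    change (x, e) = (1 * x * 1⁻¹, (0 : ZMod 2) + e)
    simp
  | mul_simple_left w i ih =>
    have h : ∀ p, cs.parityHom (cs.simple i * w) p = cs.parityStep i (cs.parityHom w p) := by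
      intro p
      rw [map_mul]
      change cs.parityHom (cs.simple i) (cs.parityHom w p) = _
      rw [parityHom, lift_apply_simple]
    rw [parity, h, h, ih, ih]
    simp only [parityStep, add_zero, mul_inv_rev, inv_simple, mul_assoc, Prod.mk.injEq, true_and]
    ring

open Classical in
theorem parity_simple (i : B) (x : W) :
    cs.parity (cs.simple i) x = if x = cs.simple i then 1 else 0 := by
  simp [parity, parityHom, parityStep]

theorem parity_mul (u w x : W) :
    cs.parity (u * w) x = cs.parity u (w * x * w⁻¹) + cs.parity w x := by
  rw [parity, map_mul]
  change (cs.parityHom u (cs.parityHom w (x, 0))).2 = _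
  rw [parityHom_apply, parityHom_apply, add_zero]

theorem parity_wordProd_of_notMem (ω : List B) (x : W) (h : x ∉ cs.rightInvSeq ω) :
    cs.parity (cs.wordProd ω) x = 0 := by
  classical
  induction ω with
  | nil =>
    rw [wordProd_nil, parity, map_one]
    rfl
  | cons i ω ih =>
    simp only [rightInvSeq, List.mem_cons, not_or] at h
    rw [wordProd_cons, parity_mul, ih h.2, parity_simple, if_neg, add_zero]
    intro h'
    apply h.1
    rw [← h']; group

theorem isRightDescent_of_parity_ne_zero {w : W} {j : B}
    (h : cs.parity w (cs.simple j) ≠ 0) : cs.IsRightDescent w j := by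
  obtain ⟨ω, hω, rfl⟩ := cs.exists_isReduced w
  have hm : cs.simple j ∈ cs.rightInvSeq ω := by
    by_contra hm
    exact h (cs.parity_wordProd_of_notMem ω _ hm)
  exact (cs.isRightInversion_of_mem_rightInvSeq hω hm).2

theorem isRightDescent_iff_parity {w : W} {j : B} :
    cs.IsRightDescent w j ↔ cs.parity w (cs.simple j) ≠ 0 := by
  classical
  refine ⟨fun h h0 => ?_, cs.isRightDescent_of_parity_ne_zero⟩
  have h1 : cs.parity (w * cs.simple j) (cs.simple j) = 1 := by
    rw [parity_mul, parity_simple]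
    simp [h0]
  exact (cs.isRightDescent_iff_not_isRightDescent_mul.1 h)
    (cs.isRightDescent_of_parity_ne_zero (by rw [h1]; exact one_ne_zero))

theorem simple_mul_eq_mul_simple {w : W} {i j : B} (h1 : ¬ cs.IsRightDescent w j)
    (h2 : cs.IsRightDescent (cs.simple i * w) j) : cs.simple i * w = w * cs.simple j := by
  classical
  rw [isRightDescent_iff_parity, not_not] at h1
  rw [isRightDescent_iff_parity, parity_mul, h1, add_zero, parity_simple] at h2
  have : w * cs.simple j * w⁻¹ = cs.simple i := by
    by_contra h
    exact h2 (if_neg h)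
  rw [← this]; group

end CoxeterSystem

/-! ### The Hecke algebra -/

/-- The ring `ℤ[q⁻¹, q]`. -/
abbrev LaurentZ : Type := LaurentPolynomial ℤ

/-- The indeterminate `q`. -/
def qVar : LaurentZ := LaurentPolynomial.T 1

/-- The Hecke algebra of a Coxeter system: the free `ℤ[q⁻¹, q]`-module on the set `W`, with the
product that is defined below and computed in `HeckeAlgebra.T_mul_T_simple`. -/
def HeckeAlgebra {B W : Type*} [Group W] {M : CoxeterMatrix B} (_cs : CoxeterSystem M W) : Type _ :=
  W →₀ LaurentZ

namespace HeckeAlgebra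

variable {B W : Type*} [Group W] {M : CoxeterMatrix B} (cs : CoxeterSystem M W)

instance : AddCommGroup (HeckeAlgebra cs) := inferInstanceAs (AddCommGroup (W →₀ LaurentZ))

instance : Module LaurentZ (HeckeAlgebra cs) := inferInstanceAs (Module LaurentZ (W →₀ LaurentZ))

/-- The standard basis `(T_w)_{w ∈ W}`. -/
def basis : Module.Basis W LaurentZ (HeckeAlgebra cs) :=
  Module.Basis.ofRepr (LinearEquiv.refl LaurentZ (W →₀ LaurentZ))

/-- The basis element `T_w`. -/
def T (w : W) : HeckeAlgebra cs := basis cs w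

open Classical in
/-- Right multiplication by `T_s`. -/
def rightMul (i : B) : Module.End LaurentZ (HeckeAlgebra cs) :=
  (basis cs).constr LaurentZ fun w =>
    if cs.IsRightDescent w i then qVar • T cs (w * cs.simple i) + (qVar - 1) • T cs w
    else T cs (w * cs.simple i)

open Classical in
/-- Left multiplication by `T_s`. -/
def leftMul (i : B) : Module.End LaurentZ (HeckeAlgebra cs) :=
  (basis cs).constr LaurentZ fun w =>
    if cs.IsLeftDescent w i then qVar • T cs (cs.simple i * w) + (qVar - 1) • T cs w
    else T cs (cs.simple i * w)

open Classical in
theorem rightMul_T (i : B) (w : W) : rightMul cs i (T cs w) =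
    if cs.IsRightDescent w i then qVar • T cs (w * cs.simple i) + (qVar - 1) • T cs w
    else T cs (w * cs.simple i) := by
  exact (basis cs).constr_basis LaurentZ _ w

open Classical in
theorem leftMul_T (i : B) (w : W) : leftMul cs i (T cs w) =
    if cs.IsLeftDescent w i then qVar • T cs (cs.simple i * w) + (qVar - 1) • T cs w
    else T cs (cs.simple i * w) := by
  exact (basis cs).constr_basis LaurentZ _ w

theorem leftMul_comp_rightMul (i j : B) :
    leftMul cs i * rightMul cs j = rightMul cs j * leftMul cs i := by
  classical
  refine (basis cs).ext fun w => ?_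
  change leftMul cs i (rightMul cs j (T cs w)) = rightMul cs j (leftMul cs i (T cs w))
  have hl := cs.length_simple_mul w i
  have hr := cs.length_mul_simple w j
  have hlr := cs.length_mul_simple (cs.simple i * w) j
  have hrl := cs.length_simple_mul (w * cs.simple j) i
  have key1 := @CoxeterSystem.simple_mul_eq_mul_simple _ _ _ _ cs w i j
  have key2 := @CoxeterSystem.simple_mul_eq_mul_simple _ _ _ _ cs (cs.simple i * w) i j
  rw [mul_assoc] at hlr
  rw [cs.simple_mul_simple_cancel_left, mul_assoc] at key2
  simp only [CoxeterSystem.IsRightDescent, mul_assoc] at key1 key2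
  rw [rightMul_T, leftMul_T]
  by_cases c1 : cs.IsLeftDescent w i <;> by_cases c2 : cs.IsRightDescent w j
  all_goals
    by_cases c3 : cs.IsLeftDescent (w * cs.simple j) i <;>
    by_cases c4 : cs.IsRightDescent (cs.simple i * w) j
  all_goals
    simp only [c1, c2, if_true, if_false, map_add, map_smul, leftMul_T, rightMul_T, c3, c4,
      mul_assoc]
    try simp only [CoxeterSystem.IsRightDescent, CoxeterSystem.IsLeftDescent, mul_assoc] at c1 c2 c3 c4
  all_goals try (exfalso; omega)
  all_goals try module
  all_goals first
    | (have h := key1 (by omega) (by omega); rw [h])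
    | (have h := key2 (by omega) (by omega)
       have h' : cs.simple i * w = w * cs.simple j := by
         conv_lhs => rw [h]
         rw [cs.simple_mul_simple_cancel_left]
       rw [h'])

/-- A chosen reduced word of `w`. -/
def word (w : W) : List B := (cs.exists_isReduced w).choose

theorem word_isReduced (w : W) : cs.IsReduced (word cs w) := (cs.exists_isReduced w).choose_spec.1

theorem wordProd_word (w : W) : cs.wordProd (word cs w) = w :=
  (cs.exists_isReduced w).choose_spec.2.symm

/-- Right multiplication by `T_{s₁} ⋯ T_{sₖ}`. -/
def rightMulWord (ω : List B) : Module.End LaurentZ (HeckeAlgebra cs) :=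
  (ω.reverse.map (rightMul cs)).prod

theorem rightMulWord_T_one {ω : List B} (h : cs.IsReduced ω) :
    rightMulWord cs ω (T cs 1) = T cs (cs.wordProd ω) := by
  classical
  induction ω using List.reverseRecOn with
  | nil => simp [rightMulWord]
  | append_singleton ω i ih =>
    have h' : cs.IsReduced ω := by simpa using h.take ω.length
    have e : rightMulWord cs (ω ++ [i]) = rightMul cs i * rightMulWord cs ω := by
      simp [rightMulWord]
    have hn : ¬ cs.IsRightDescent (cs.wordProd ω) i := by
      have h1 := h.eq
      have h2 := h'.eq
      rw [cs.wordProd_append, cs.wordProd_singleton, List.length_append, List.length_singleton,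
        ← h2] at h1
      rwa [cs.not_isRightDescent_iff]
    rw [e, Module.End.mul_apply, ih h', rightMul_T, if_neg hn, cs.wordProd_append,
      cs.wordProd_singleton]

/-- Right multiplication by an element of the Hecke algebra. -/
def rightMulHom : HeckeAlgebra cs →ₗ[LaurentZ] Module.End LaurentZ (HeckeAlgebra cs) :=
  (basis cs).constr LaurentZ fun w => rightMulWord cs (word cs w)

/-- The product `a * b`; on basis elements it is `T_v * T_w = (T_v · T_{s₁}) ⋯ T_{sₖ}` for a reduced
word `s₁ ⋯ sₖ` of `w`, where `· T_s` is given by the multiplication rule `rightMul`. -/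
instance : Mul (HeckeAlgebra cs) := ⟨fun a b => rightMulHom cs b a⟩

instance : One (HeckeAlgebra cs) := ⟨T cs 1⟩

theorem mul_def (a b : HeckeAlgebra cs) : a * b = rightMulHom cs b a := rfl

theorem one_def : (1 : HeckeAlgebra cs) = T cs 1 := rfl

theorem rightMulHom_T (w : W) : rightMulHom cs (T cs w) = rightMulWord cs (word cs w) := by
  exact (basis cs).constr_basis LaurentZ _ w

theorem one_mul' (b : HeckeAlgebra cs) : rightMulHom cs b (T cs 1) = b := by
  have h : (LinearMap.applyₗ (T cs 1)) ∘ₗ rightMulHom cs = LinearMap.id := by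
    refine (basis cs).ext fun w => ?_
    change rightMulHom cs (T cs w) (T cs 1) = T cs w
    rw [rightMulHom_T, rightMulWord_T_one cs (word_isReduced cs w), wordProd_word]
  exact LinearMap.congr_fun h b

theorem rightMulWord_commute (ω : List B) (i : B) :
    Commute (leftMul cs i) (rightMulWord cs ω) := by
  refine Commute.list_prod_right _ _ fun x hx => ?_
  obtain ⟨j, -, rfl⟩ := List.mem_map.1 hx
  exact leftMul_comp_rightMul cs i j

theorem rightMulHom_commute (b : HeckeAlgebra cs) (i : B) :
    Commute (leftMul cs i) (rightMulHom cs b) := by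
  rw [← (basis cs).linearCombination_repr b, Finsupp.linearCombination_apply, Finsupp.sum, map_sum]
  refine Commute.sum_right _ _ _ fun w _ => ?_
  rw [map_smul]
  refine Commute.smul_right ?_ _
  change Commute _ (rightMulHom cs (T cs w))
  rw [rightMulHom_T]
  exact rightMulWord_commute cs _ i

/-- An operator commuting with all left multiplications is determined by its value at `T_e`. -/
theorem ext_of_commute {f g : Module.End LaurentZ (HeckeAlgebra cs)}
    (hf : ∀ i, Commute (leftMul cs i) f) (hg : ∀ i, Commute (leftMul cs i) g)
    (h : f (T cs 1) = g (T cs 1)) : f = g := by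
  classical
  refine (basis cs).ext fun w => ?_
  change f (T cs w) = g (T cs w)
  obtain ⟨ω, hω, rfl⟩ := cs.exists_isReduced w
  induction ω with
  | nil => simpa using h
  | cons i ω ih =>
    have h' : cs.IsReduced ω := by simpa using hω.drop 1
    have hn : ¬ cs.IsLeftDescent (cs.wordProd ω) i := by
      have h1 := hω.eq
      rw [cs.wordProd_cons, List.length_cons, ← h'.eq] at h1
      rwa [cs.not_isLeftDescent_iff]
    have e : T cs (cs.wordProd (i :: ω)) = leftMul cs i (T cs (cs.wordProd ω)) := by
      rw [leftMul_T, if_neg hn, cs.wordProd_cons]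
    have hf' := LinearMap.congr_fun (hf i).eq (T cs (cs.wordProd ω))
    have hg' := LinearMap.congr_fun (hg i).eq (T cs (cs.wordProd ω))
    simp only [Module.End.mul_apply] at hf' hg'
    rw [e, ← hf', ← hg', ih h']

theorem mul_assoc' (a b c : HeckeAlgebra cs) : a * b * c = a * (b * c) := by
  have h : rightMulHom cs c * rightMulHom cs b = rightMulHom cs (rightMulHom cs c b) := by
    refine ext_of_commute cs
      (fun i => (rightMulHom_commute cs c i).mul_right (rightMulHom_commute cs b i))
      (rightMulHom_commute cs _) ?_
    rw [Module.End.mul_apply, one_mul', one_mul']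
  exact LinearMap.congr_fun h a

theorem rightMulHom_one : rightMulHom cs (T cs 1) = 1 :=
  ext_of_commute cs (rightMulHom_commute cs _) (fun i => Commute.one_right _)
    (by rw [one_mul', Module.End.one_apply])

instance : Ring (HeckeAlgebra cs) :=
  { (inferInstance : AddCommGroup (HeckeAlgebra cs)),
    (inferInstance : Mul (HeckeAlgebra cs)),
    (inferInstance : One (HeckeAlgebra cs)) with
    mul_assoc := mul_assoc' cs
    one_mul := one_mul' cs
    mul_one := fun a => by rw [mul_def, one_def, rightMulHom_one, Module.End.one_apply]
    left_distrib := fun a b c => by simp [mul_def]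
    right_distrib := fun a b c => by simp [mul_def]
    zero_mul := fun a => by simp [mul_def]
    mul_zero := fun a => by simp [mul_def] }

instance : Algebra LaurentZ (HeckeAlgebra cs) :=
  Algebra.ofModule (fun r x y => by simp [mul_def]) (fun r x y => by simp [mul_def])

open Classical in
/-- The multiplication rule of the Hecke algebra. -/
theorem T_mul_T_simple (w : W) (i : B) : T cs w * T cs (cs.simple i) =
    if cs.IsRightDescent w i then qVar • T cs (w * cs.simple i) + (qVar - 1) • T cs w
    else T cs (w * cs.simple i) := by
  have h : rightMulHom cs (T cs (cs.simple i)) = rightMul cs i := by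
    refine ext_of_commute cs (rightMulHom_commute cs _)
      (fun k => leftMul_comp_rightMul cs k i) ?_
    rw [one_mul', rightMul_T, if_neg (cs.not_isRightDescent_one i), one_mul]
  rw [mul_def, h, rightMul_T]

theorem one_eq_T : (1 : HeckeAlgebra cs) = T cs 1 := rfl

end HeckeAlgebra

/-! ### The representations on the group module `V_W` -/

section Representations

variable {B W : Type*} [Group W] {M : CoxeterMatrix B} (cs : CoxeterSystem M W)

/-- `V_W`, the free `ℤ`-module on the set `W`. -/
abbrev GroupModule (W : Type*) : Type _ := W →₀ ℤ

open Classical in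
/-- The projection `W → W^{s}`: the component `w^{s}` of the factorization `w = w^{s} w_{s}`. -/
def CoxeterSystem.proj (i : B) (w : W) : W :=
  if cs.IsRightDescent w i then w * cs.simple i else w

/-- `proj i w` is the unique `v` with `ℓ(vs) > ℓ(v)` and `w ∈ v W_{s}`. -/
theorem CoxeterSystem.eq_proj_iff (i : B) (w v : W) :
    v = cs.proj i w ↔ cs.length v < cs.length (v * cs.simple i) ∧
      ∃ u ∈ Subgroup.closure {cs.simple i}, w = v * u := by
  classical
  have hcl : ∀ u : W, u ∈ Subgroup.closure {cs.simple i} ↔ u = 1 ∨ u = cs.simple i := by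
    intro u
    rw [Subgroup.mem_closure_singleton]
    constructor
    · rintro ⟨n, rfl⟩
      rcases Int.even_or_odd' n with ⟨k, rfl | rfl⟩
      · left; rw [zpow_mul, zpow_ofNat, cs.simple_sq, one_zpow]
      · right; rw [zpow_add, zpow_mul, zpow_ofNat, cs.simple_sq, one_zpow, one_mul, zpow_one]
    · rintro (rfl | rfl)
      · exact ⟨0, zpow_zero _⟩
      · exact ⟨1, zpow_one _⟩
  simp only [hcl]
  unfold CoxeterSystem.proj CoxeterSystem.IsRightDescent
  have hne := cs.length_mul_simple_ne w i
  constructor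
  · rintro rfl
    split_ifs with h
    · exact ⟨by simpa using h, cs.simple i, Or.inr rfl, by simp⟩
    · exact ⟨by omega, 1, Or.inl rfl, by simp⟩
  · rintro ⟨h1, u, rfl | rfl, rfl⟩
    · rw [if_neg (by simpa using h1.le)]; simp
    · rw [if_pos (by simpa using h1)]; simp

/-- The idempotent endomorphism `P^s` of `V_W`. -/
def CoxeterSystem.projLin (i : B) : GroupModule W →ₗ[ℤ] GroupModule W :=
  Finsupp.lmapDomain ℤ ℤ (cs.proj i)

/-- `f^q(s) = q I - (q + 1) P^s` on `ℤ[q⁻¹, q] ⊗ V_W`. -/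
def repQ (i : B) : Module.End LaurentZ (LaurentZ ⊗[ℤ] GroupModule W) :=
  qVar • LinearMap.id - (qVar + 1) • (cs.projLin i).baseChange LaurentZ

/-- `f^{-1}(s) = -I + (q + 1) P^s` on `ℤ[q⁻¹, q] ⊗ V_W`. -/
def repNegOne (i : B) : Module.End LaurentZ (LaurentZ ⊗[ℤ] GroupModule W) :=
  -LinearMap.id + (qVar + 1) • (cs.projLin i).baseChange LaurentZ

/-- The specialization `ℤ[q⁻¹, q] → ℚ`, `q ↦ t`, for a nonzero rational number `t`. -/
def evalAt (t : ℚ) (ht : t ≠ 0) : LaurentZ →+* ℚ :=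
  LaurentPolynomial.eval₂ (Int.castRingHom ℚ) (Units.mk0 t ht)

/-- The specialization `ℤ[q⁻¹, q] ⊗ V → ℚ ⊗ V`, `a ⊗ v ↦ a(t) ⊗ v`. -/
def specialize (W : Type*) (t : ℚ) (ht : t ≠ 0) :
    LaurentZ ⊗[ℤ] GroupModule W →+ ℚ ⊗[ℤ] GroupModule W :=
  (LinearMap.rTensor (GroupModule W) (evalAt t ht).toIntAlgHom.toLinearMap).toAddMonoidHom

theorem specialize_tmul {W : Type*} (t : ℚ) (ht : t ≠ 0) (a : LaurentZ) (v : GroupModule W) :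
    specialize W t ht (a ⊗ₜ v) = evalAt t ht a ⊗ₜ v :=
  rfl

/-- `G` is the specialization at `q = t` of the endomorphism `F`. As the image of `specialize`
spans `ℚ ⊗ V` over `ℚ`, this determines the `ℚ`-linear map `G`. -/
def IsSpecialization (t : ℚ) (ht : t ≠ 0)
    (F : Module.End LaurentZ (LaurentZ ⊗[ℤ] GroupModule W))
    (G : Module.End ℚ (ℚ ⊗[ℤ] GroupModule W)) : Prop :=
  ∀ v, G (specialize W t ht v) = specialize W t ht (F v)

end Representations

end

/-! Since `P^s` is idempotent, `f^x(s)` has the eigenvalues `-1` and `q` on its image and kernel,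
the two roots of the quadratic relation of `T_s`. For `m(s,t) = 2` the projections commute. A
right-angled Hecke algebra is presented by the quadratic and commutation relations
(`HeckeAlgebra.exists_algHom`), so `σ` exists; this rests on the word property
`prod_map_eq_of_isReduced`, which comes from the fact that distinct right descents commute
(`eq_two_of_isRightDescent`).

Faithfulness is a count of lengths. Collecting powers writes each `g` as `s₁^{n₁} ⋯ s_k^{n_k}` with
all `nᵢ ≠ 0` and `w = s₁ ⋯ s_k` reduced (`exists_syllableProd_eq`). With eigenvalue `x` on the
kernel and `y` on the image, `s^n` sends `v` to `x^n v + (y^n - x^n) P^s v`, and `P^s` shortens a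
basis element by at most one. Hence the coefficient of `1` in `g · w` comes only from projecting at
all `k` steps: it is the product of the `y^{nᵢ} - x^{nᵢ}`, nonzero because `x / y` is not a root of
unity (`coeffOne_ne_zero`). If `g` acts trivially, then `w = 1`, so `k = 0` and `g = 1`. Injectivity
of `φ` follows from a single specialization. -/

open scoped TensorProduct

noncomputable section

/-! ### Right descents in right-angled Coxeter groups -/

namespace CoxeterMatrix.IsRightAngled

variable {B : Type*} {M : CoxeterMatrix B}

theorem eq_two_or_zero (hM : M.IsRightAngled) {i j : B} (h : i ≠ j) : M i j = 2 ∨ M i j = 0 :=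
  (hM i j).resolve_left (M.off_diagonal i j h)

end CoxeterMatrix.IsRightAngled

namespace CoxeterSystem

variable {B W : Type*} [Group W] {M : CoxeterMatrix B} (cs : CoxeterSystem M W)

theorem commute_simple_of_eq_two {i j : B} (h : M i j = 2) :
    Commute (cs.simple i) (cs.simple j) := by
  have h1 := cs.simple_mul_simple_pow i j
  rw [h, pow_two, ← eq_inv_iff_mul_eq_one, mul_inv_rev, inv_simple, inv_simple] at h1
  exact h1

/-- A character to `ZMod 2`, nontrivial on the generator `i` alone, separates it from the others; it
is well defined because no off-diagonal exponent is odd. -/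
theorem simple_injective (hM : M.IsRightAngled) : Function.Injective cs.simple := by
  classical
  intro i j hij
  by_contra hne
  let f : B → Multiplicative (ZMod 2) := fun k => if k = i then Multiplicative.ofAdd 1 else 1
  have hsq : ∀ x : Multiplicative (ZMod 2), x ^ 2 = 1 := by decide
  have hf : M.IsLiftable f := by
    intro k l
    change (f k * f l) ^ (M k l) = 1
    by_cases hkl : k = l
    · rw [hkl, ← pow_two, hsq, one_pow]
    · rcases hM.eq_two_or_zero hkl with h | h <;> rw [h]
      · exact hsq _
      · exact pow_zero _
  have h := congrArg (cs.lift ⟨f, hf⟩) hij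
  rw [lift_apply_simple, lift_apply_simple] at h
  simp only [f, if_true, if_neg (Ne.symm hne)] at h
  exact absurd h (by decide)

/-- The product of two generators without a braid relation has infinite order. -/
theorem simple_mul_simple_pow_succ_ne_one (hM : M.IsRightAngled) {i j : B} (hij : i ≠ j)
    (h : M i j = 0) (n : ℕ) : (cs.simple i * cs.simple j) ^ (n + 1) ≠ 1 := by
  classical
  -- The infinite dihedral group detects the order: `i` and `j` go to reflections whose product is
  -- the translation `r 1`, and all other generators go to `1`.
  let f : B → DihedralGroup 0 := fun k =>
    if k = i then DihedralGroup.sr 0 else if k = j then DihedralGroup.sr 1 else 1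
  have hfi : f i = DihedralGroup.sr 0 := if_pos rfl
  have hfj : f j = DihedralGroup.sr 1 := by
    simp only [f, if_neg hij.symm, if_true]
  have hsq : ∀ k, f k * f k = 1 := by
    intro k
    simp only [f]
    split_ifs <;> simp [← DihedralGroup.r_zero]
  have hf : M.IsLiftable f := by
    intro k l
    change (f k * f l) ^ (M k l) = 1
    by_cases hkl : k = l
    · subst hkl
      rw [hsq, one_pow]
    rcases hM.eq_two_or_zero hkl with h2 | h0
    · rw [h2]
      -- A pair with exponent `2` is not the pair `i`, `j`, so one of its members is killed.
      have hk : f k = 1 ∨ f l = 1 := by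
        by_contra hc
        rw [not_or] at hc
        have hmem : ∀ m, f m ≠ 1 → m = i ∨ m = j := by
          intro m hm
          by_contra hm'
          rw [not_or] at hm'
          exact hm (by simp only [f, if_neg hm'.1, if_neg hm'.2])
        have h' : M j i = 0 := by rw [M.symmetric, h]
        rcases hmem k hc.1 with rfl | rfl <;> rcases hmem l hc.2 with rfl | rfl <;> simp_all
      rcases hk with hk | hk <;> simp [hk, pow_two, hsq]
    · rw [h0, pow_zero]
  intro hn
  have := congrArg (cs.lift ⟨f, hf⟩) hn
  rw [map_pow, map_mul, lift_apply_simple, lift_apply_simple, map_one, hfi, hfj,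
    DihedralGroup.sr_mul_sr, DihedralGroup.r_pow, DihedralGroup.one_def] at this
  have h2 := DihedralGroup.r.inj this
  have h3 : ((1 : ℤ) - 0) * ((n + 1 : ℕ) : ℤ) = 0 := h2
  push_cast at h3
  omega

theorem parity_pow (i j : B) (n : ℕ) (x : W)
    (h : ∀ l, (cs.simple i * cs.simple j) ^ l * x ≠ cs.simple j) :
    cs.parity ((cs.simple i * cs.simple j) ^ n) x = 0 := by
  classical
  have h1 : cs.parityHom ((cs.simple i * cs.simple j) ^ n) =
      (cs.parityStep i * cs.parityStep j) ^ n := by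
    rw [map_pow, map_mul, parityHom, lift_apply_simple, lift_apply_simple]
  rw [parity, h1, parityStep_pow]
  simp only [zero_add]
  refine Finset.sum_eq_zero fun l _ => if_neg fun hx => h l ?_
  rw [hx]
  group

/-- A product of `i`, `j` without a braid relation that ends in `j` does not have the right
descent `i`. -/
theorem parity_alternating_eq_zero (hM : M.IsRightAngled) {i j : B} (hij : i ≠ j)
    (h : M i j = 0) (n : ℕ) :
    cs.parity ((cs.simple i * cs.simple j) ^ n) (cs.simple i) = 0 ∧
      cs.parity (cs.simple j * (cs.simple i * cs.simple j) ^ n) (cs.simple i) = 0 := by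
  have key := cs.simple_mul_simple_pow_succ_ne_one hM hij h
  have key' : ∀ l, (cs.simple i * cs.simple j) ^ l * cs.simple i ≠ cs.simple j := by
    intro l hl
    refine key l ?_
    rw [pow_succ, ← mul_assoc, hl, simple_mul_simple_self]
  have h1 := cs.parity_pow i j n _ key'
  refine ⟨h1, ?_⟩
  rw [parity_mul, h1, add_zero, parity_simple, if_neg]
  intro hc
  -- Conjugation by `s_i` inverts `s_i s_j`, so the conjugate of `s_i` by `(s_i s_j)^n` is `(s_i
  -- s_j)^(2n) s_i`, which is again covered by `key'`.
  have hconj : cs.simple i * ((cs.simple i * cs.simple j) ^ n)⁻¹ =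
      (cs.simple i * cs.simple j) ^ n * cs.simple i := by
    have h2 : cs.simple i * (cs.simple i * cs.simple j)⁻¹ * (cs.simple i)⁻¹ =
        cs.simple i * cs.simple j := by
      simp [mul_assoc]
    rw [← inv_pow, ← mul_inv_eq_iff_eq_mul, ← conj_pow, h2]
  rw [mul_assoc, hconj, ← mul_assoc, ← pow_add] at hc
  exact key' _ hc

/-- Alternating words are sorted by their last letter: `j` in the first family, `i` in the second,
with the empty word in both. Left multiplication by a generator keeps the last letter unless it
starts from the empty word. -/
theorem mem_closure_pair {i j : B} {u : W}
    (hu : u ∈ Subgroup.closure {cs.simple i, cs.simple j}) :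
    (∃ n, u = (cs.simple i * cs.simple j) ^ n ∨
      u = cs.simple j * (cs.simple i * cs.simple j) ^ n) ∨
    ∃ n, u = (cs.simple j * cs.simple i) ^ n ∨
      u = cs.simple i * (cs.simple j * cs.simple i) ^ n := by
  have step : ∀ (i j : B) (u : W), (∃ n, u = (cs.simple i * cs.simple j) ^ n ∨
      u = cs.simple j * (cs.simple i * cs.simple j) ^ n) →
      (∃ n, cs.simple j * u = (cs.simple i * cs.simple j) ^ n ∨
      cs.simple j * u = cs.simple j * (cs.simple i * cs.simple j) ^ n) ∧
      ((∃ n, cs.simple i * u = (cs.simple i * cs.simple j) ^ n ∨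
      cs.simple i * u = cs.simple j * (cs.simple i * cs.simple j) ^ n) ∨
      cs.simple i * u = cs.simple i * (cs.simple j * cs.simple i) ^ 0) := by
    rintro i j u ⟨n, rfl | rfl⟩
    · refine ⟨⟨n, Or.inr rfl⟩, ?_⟩
      cases n with
      | zero => exact Or.inr (by simp)
      | succ n => exact Or.inl ⟨n, Or.inr (by rw [pow_succ']; simp [mul_assoc])⟩
    · refine ⟨⟨n, Or.inl (by simp)⟩, Or.inl ⟨n + 1, Or.inl ?_⟩⟩
      rw [pow_succ', mul_assoc]
  have main : ∀ x ∈ ({cs.simple i, cs.simple j} : Set W), ∀ u : W,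
      ((∃ n, u = (cs.simple i * cs.simple j) ^ n ∨
        u = cs.simple j * (cs.simple i * cs.simple j) ^ n) ∨
      ∃ n, u = (cs.simple j * cs.simple i) ^ n ∨
        u = cs.simple i * (cs.simple j * cs.simple i) ^ n) →
      ((∃ n, x * u = (cs.simple i * cs.simple j) ^ n ∨
        x * u = cs.simple j * (cs.simple i * cs.simple j) ^ n) ∨
      ∃ n, x * u = (cs.simple j * cs.simple i) ^ n ∨
        x * u = cs.simple i * (cs.simple j * cs.simple i) ^ n) := by
    rintro x (rfl | rfl) u (hu | hu)
    · rcases (step i j u hu).2 with h | h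
      · exact Or.inl h
      · exact Or.inr ⟨0, Or.inr h⟩
    · exact Or.inr (step j i u hu).1
    · exact Or.inl (step i j u hu).1
    · rcases (step j i u hu).2 with h | h
      · exact Or.inr h
      · exact Or.inl ⟨0, Or.inr h⟩
  induction hu using Subgroup.closure_induction_left with
  | one => exact Or.inl ⟨0, Or.inl (by simp)⟩
  | mul_left x hx y _ ih => exact main x hx y ih
  | inv_mul_cancel x hx y _ ih =>
    have hxi : x⁻¹ = x := by rcases hx with rfl | rfl <;> simp
    rw [hxi]
    exact main x hx y ih

/-- Two distinct right descents of an element of a right-angled Coxeter group commute. -/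
theorem eq_two_of_isRightDescent (hM : M.IsRightAngled) {i j : B} (hij : i ≠ j) {w : W}
    (hi : cs.IsRightDescent w i) (hj : cs.IsRightDescent w j) : M i j = 2 := by
  refine (hM.eq_two_or_zero hij).resolve_right fun h0 => ?_
  set H := Subgroup.closure {cs.simple i, cs.simple j} with hH
  have hex : ∃ n, ∃ v u, u ∈ H ∧ v * u = w ∧ cs.length v = n := ⟨_, w, 1, H.one_mem, by simp, rfl⟩
  classical
  obtain ⟨v, u, hu, rfl, hv⟩ := Nat.find_spec hex
  -- `v` is of minimal length in the coset `wH`; a right inversion of `v` lying in `H` would give a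
  -- shorter representative. By the cocycle rule, the descents `i` and `j` of `vu` can then be read
  -- off from `u` alone.
  have hmin : ∀ r ∈ H, cs.parity v r = 0 := by
    intro r hr
    obtain ⟨ω, hω, rfl⟩ := cs.exists_isReduced v
    by_contra hc
    have hm : r ∈ cs.rightInvSeq ω := by
      by_contra hm
      exact hc (cs.parity_wordProd_of_notMem ω _ hm)
    have hlt := (cs.isRightInversion_of_mem_rightInvSeq hω hm).2
    rw [hv] at hlt
    exact Nat.find_min hex hlt
      ⟨_, r⁻¹ * u, H.mul_mem (H.inv_mem hr) hu, by group, rfl⟩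
  have hiH : cs.simple i ∈ H := Subgroup.subset_closure (by simp)
  have hjH : cs.simple j ∈ H := Subgroup.subset_closure (by simp)
  rw [isRightDescent_iff_parity, parity_mul,
    hmin _ (H.mul_mem (H.mul_mem hu ‹_›) (H.inv_mem hu)), zero_add] at hi hj
  rcases cs.mem_closure_pair hu with ⟨n, rfl | rfl⟩ | ⟨n, rfl | rfl⟩
  · exact hi (cs.parity_alternating_eq_zero hM hij h0 n).1
  · exact hi (cs.parity_alternating_eq_zero hM hij h0 n).2
  · exact hj (cs.parity_alternating_eq_zero hM hij.symm (by rw [M.symmetric, h0]) n).1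
  · exact hj (cs.parity_alternating_eq_zero hM hij.symm (by rw [M.symmetric, h0]) n).2

theorem isReduced_concat_iff {ω : List B} {i : B} :
    cs.IsReduced (ω ++ [i]) ↔ cs.IsReduced ω ∧ ¬ cs.IsRightDescent (cs.wordProd ω) i := by
  have h1 := cs.length_wordProd_le ω
  have h2 := cs.length_mul_simple (cs.wordProd ω) i
  unfold IsReduced IsRightDescent
  rw [wordProd_append, wordProd_singleton, List.length_append, List.length_singleton]
  omega

/-- A right descent of a reduced word in a right-angled Coxeter group can be moved to the end of
the word by commutations. -/
theorem exists_eq_append_of_isRightDescent (hM : M.IsRightAngled) {ω : List B}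
    (hω : cs.IsReduced ω) {i : B} (hi : cs.IsRightDescent (cs.wordProd ω) i) :
    ∃ α β, ω = α ++ i :: β ∧ ∀ j ∈ β, M i j = 2 := by
  induction ω using List.reverseRecOn with
  | nil => exact absurd hi (by simpa using cs.not_isRightDescent_one i)
  | append_singleton ω j ih =>
    by_cases hij : i = j
    · exact ⟨ω, [], by rw [hij], by simp⟩
    obtain ⟨hω', hj'⟩ := cs.isReduced_concat_iff.1 hω
    have hj : cs.IsRightDescent (cs.wordProd (ω ++ [j])) j := by
      rw [isRightDescent_iff_not_isRightDescent_mul, wordProd_append, wordProd_singleton]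
      simpa using hj'
    have h2 := cs.eq_two_of_isRightDescent hM hij hi hj
    have hne : cs.simple i ≠ cs.simple j := fun h => hij (cs.simple_injective hM h)
    have hc := (cs.commute_simple_of_eq_two h2).eq
    -- The last letter `j` commutes with `i`, so deleting it does not affect the descent `i`.
    have hi' : cs.IsRightDescent (cs.wordProd ω) i := by
      rw [wordProd_append, wordProd_singleton, isRightDescent_iff_parity, parity_mul,
        parity_simple, if_neg hne, add_zero, ← hc, mul_inv_cancel_right] at hi
      exact cs.isRightDescent_of_parity_ne_zero hi
    obtain ⟨α, β, rfl, hβ⟩ := ih hω' hi'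
    refine ⟨α, β ++ [j], by simp, ?_⟩
    simp only [List.mem_append, List.mem_singleton]
    rintro k (hk | rfl)
    · exact hβ k hk
    · exact h2

end CoxeterSystem

/-! ### The word property and its consequences -/

namespace CoxeterSystem

variable {B W : Type*} [Group W] {M : CoxeterMatrix B} (cs : CoxeterSystem M W)

/-- The letter `i` commutes past `β`, and the resulting word `α β i` has the same length and
product. This extracts a descent in the word property and in the normal form for the Artin group. -/
theorem isReduced_append_and_wordProd {i : B} {α β : List B}
    (h : cs.IsReduced (α ++ i :: β)) (hβ : ∀ j ∈ β, M i j = 2) :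
    cs.IsReduced (α ++ β) ∧
      cs.wordProd (α ++ i :: β) = cs.wordProd (α ++ β) * cs.simple i ∧
      ¬ cs.IsRightDescent (cs.wordProd (α ++ β)) i := by
  have hc : Commute (cs.simple i) (cs.wordProd β) := by
    refine Commute.list_prod_right _ _ fun x hx => ?_
    obtain ⟨j, hj, rfl⟩ := List.mem_map.1 hx
    exact cs.commute_simple_of_eq_two (hβ j hj)
  have hw : cs.wordProd (α ++ i :: β) = cs.wordProd (α ++ β) * cs.simple i := by
    rw [wordProd_append, wordProd_cons, hc.eq, wordProd_append, mul_assoc]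
  have hred : cs.IsReduced ((α ++ β) ++ [i]) := by
    unfold IsReduced at h ⊢
    rw [wordProd_append, wordProd_singleton, ← hw, h]
    simp
  exact ⟨(cs.isReduced_concat_iff.1 hred).1, hw, (cs.isReduced_concat_iff.1 hred).2⟩

/-- The product of a family of elements satisfying the commutation relations over a reduced word
depends only on the element represented by the word. -/
theorem prod_map_eq_of_isReduced (hM : M.IsRightAngled) {G : Type*} [Monoid G] (f : B → G)
    (hf : ∀ i j, M i j = 2 → Commute (f i) (f j)) {ω ω' : List B} (hω : cs.IsReduced ω)
    (hω' : cs.IsReduced ω') (h : cs.wordProd ω = cs.wordProd ω') :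
    (ω.map f).prod = (ω'.map f).prod := by
  induction ω' using List.reverseRecOn generalizing ω with
  | nil =>
    have h1 : ω.length = 0 := by rw [← hω.eq, h]; simp
    rw [List.length_eq_zero_iff.1 h1]
  | append_singleton ω' i ih =>
    obtain ⟨hr', hd'⟩ := cs.isReduced_concat_iff.1 hω'
    -- The last letter of `ω'` is a descent of the common product, so it can be brought to the end
    -- of `ω` and cancelled on both sides.
    have hd : cs.IsRightDescent (cs.wordProd ω) i := by
      rw [h, isRightDescent_iff_not_isRightDescent_mul, wordProd_append, wordProd_singleton]
      simpa using hd'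
    obtain ⟨α, β, rfl, hβ⟩ := cs.exists_eq_append_of_isRightDescent hM hω hd
    obtain ⟨hr, hw, -⟩ := cs.isReduced_append_and_wordProd hω hβ
    have heq : cs.wordProd (α ++ β) = cs.wordProd ω' := by
      rw [hw, cs.wordProd_append ω', wordProd_singleton] at h
      exact mul_right_cancel h
    have hc : Commute (f i) (β.map f).prod := by
      refine Commute.list_prod_right _ _ fun x hx => ?_
      obtain ⟨j, hj, rfl⟩ := List.mem_map.1 hx
      exact hf _ _ (hβ j hj)
    have h1 := ih hr hr' heq
    simp only [List.map_append, List.prod_append, List.map_cons, List.prod_cons,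
      List.map_nil, List.prod_nil, mul_one] at h1 ⊢
    rw [hc.eq, ← mul_assoc, h1]

theorem isRightDescent_mul_simple_iff (hM : M.IsRightAngled) {i j : B} (h : M i j = 2) (w : W) :
    cs.IsRightDescent (w * cs.simple j) i ↔ cs.IsRightDescent w i := by
  have hij : i ≠ j := by
    rintro rfl
    have := M.diagonal i
    have h' : M.M i i = 2 := h
    omega
  have hc := (cs.commute_simple_of_eq_two h).eq
  rw [isRightDescent_iff_parity, isRightDescent_iff_parity, parity_mul, parity_simple,
    if_neg fun h => hij (cs.simple_injective hM h), add_zero, ← hc, mul_inv_cancel_right]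

/-! ### The projections `proj` and the commuting idempotents they induce -/

theorem proj_of_isRightDescent {i : B} {w : W} (h : cs.IsRightDescent w i) :
    cs.proj i w = w * cs.simple i := if_pos h

theorem proj_of_not_isRightDescent {i : B} {w : W} (h : ¬ cs.IsRightDescent w i) :
    cs.proj i w = w := if_neg h

theorem not_isRightDescent_proj (i : B) (w : W) : ¬ cs.IsRightDescent (cs.proj i w) i := by
  by_cases h : cs.IsRightDescent w i
  · rwa [proj_of_isRightDescent cs h, ← isRightDescent_iff_not_isRightDescent_mul]
  · rwa [proj_of_not_isRightDescent cs h]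

theorem length_le_length_proj (i : B) (w : W) : cs.length w ≤ cs.length (cs.proj i w) + 1 := by
  by_cases h : cs.IsRightDescent w i
  · rw [proj_of_isRightDescent cs h, (cs.isRightDescent_iff).1 h]
  · rw [proj_of_not_isRightDescent cs h]; omega

/-- Multiplying by one of two commuting generators does not change whether the other is a descent,
so the two case distinctions are independent. -/
theorem proj_comm (hM : M.IsRightAngled) {i j : B} (h : M i j = 2) (w : W) :
    cs.proj i (cs.proj j w) = cs.proj j (cs.proj i w) := by
  have h' : M j i = 2 := by rw [M.symmetric, h]
  have hc := (cs.commute_simple_of_eq_two h).eq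
  have h1 := cs.isRightDescent_mul_simple_iff hM h w
  have h2 := cs.isRightDescent_mul_simple_iff hM h' w
  unfold proj
  by_cases hi : cs.IsRightDescent w i <;> by_cases hj : cs.IsRightDescent w j <;>
    simp [hi, hj, h1, h2, mul_assoc, hc]

theorem projLin_single (i : B) (w : W) (n : ℤ) :
    cs.projLin i (Finsupp.single w n) = Finsupp.single (cs.proj i w) n := by
  simp [projLin]

theorem isIdempotentElem_projLin (i : B) :
    IsIdempotentElem (cs.projLin i : Module.End ℤ (GroupModule W)) := by
  refine Finsupp.lhom_ext fun w n => ?_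
  rw [Module.End.mul_apply, projLin_single, projLin_single,
    proj_of_not_isRightDescent cs (cs.not_isRightDescent_proj i w)]

theorem commute_projLin (hM : M.IsRightAngled) {i j : B} (h : M i j = 2) :
    Commute (cs.projLin i : Module.End ℤ (GroupModule W)) (cs.projLin j) := by
  refine Finsupp.lhom_ext fun w n => ?_
  rw [Module.End.mul_apply, Module.End.mul_apply, projLin_single, projLin_single, projLin_single,
    projLin_single, proj_comm cs hM h]

variable (A : Type*) [CommRing A]

/-- The extension of the scalars of `projLin` to `A`. -/
abbrev projBaseChange (i : B) : Module.End A (A ⊗[ℤ] GroupModule W) :=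
  (cs.projLin i).baseChange A

theorem isIdempotentElem_projBaseChange (i : B) :
    IsIdempotentElem (cs.projBaseChange A i) := by
  have h : (cs.projLin i : Module.End ℤ (GroupModule W)) * cs.projLin i = cs.projLin i :=
    cs.isIdempotentElem_projLin i
  rw [IsIdempotentElem, projBaseChange, ← LinearMap.baseChange_mul, h]

theorem commute_projBaseChange (hM : M.IsRightAngled) {i j : B} (h : M i j = 2) :
    Commute (cs.projBaseChange A i) (cs.projBaseChange A j) := by
  rw [Commute, SemiconjBy, projBaseChange, projBaseChange, ← LinearMap.baseChange_mul,
    ← LinearMap.baseChange_mul, (cs.commute_projLin hM h).eq]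

end CoxeterSystem

/-! ### Elements with two eigenvalues -/

namespace IsIdempotentElem

variable {A E : Type*} [CommRing A] [Ring E] [Algebra A E] {p : E} (hp : IsIdempotentElem p)

/-- For an idempotent `p`, the morphism `(x, y) ↦ x (1 - p) + y p`. -/
def twoEigen : A × A →* E where
  toFun x := x.1 • (1 - p) + x.2 • p
  map_one' := by simp
  map_mul' x y := by
    have h : p * p = p := hp
    simp only [add_mul, mul_add, smul_mul_assoc, mul_smul_comm, sub_mul, mul_sub, one_mul,
      mul_one, h, Prod.fst_mul, Prod.snd_mul]
    module

theorem twoEigen_apply (x : A × A) : hp.twoEigen x = x.1 • (1 - p) + x.2 • p := rfl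

/-- The restriction of `twoEigen` to the units. -/
def twoEigenUnits : Aˣ × Aˣ →* Eˣ :=
  (Units.map hp.twoEigen).comp MulEquiv.prodUnits.symm.toMonoidHom

theorem val_twoEigenUnits (x y : Aˣ) :
    (hp.twoEigenUnits (x, y) : E) = (x : A) • (1 - p) + (y : A) • p := rfl

theorem commute_twoEigen {p' : E} (hp' : IsIdempotentElem p') (h : Commute p p') (x y : A × A) :
    Commute (hp.twoEigen x) (hp'.twoEigen y) := by
  rw [twoEigen_apply, twoEigen_apply]
  have h1 : Commute (1 - p) p' := (Commute.one_left _).sub_left h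
  refine Commute.add_left (Commute.add_right ?_ ?_) (Commute.add_right ?_ ?_)
  · exact (((Commute.one_right _).sub_right h1).smul_left _).smul_right _
  · exact (h1.smul_left _).smul_right _
  · exact (((Commute.one_right _).sub_right h).smul_left _).smul_right _
  · exact (h.smul_left _).smul_right _

end IsIdempotentElem

/-! ### The universal property of the Hecke algebra -/

namespace HeckeAlgebra

variable {B W : Type*} [Group W] {M : CoxeterMatrix B} (cs : CoxeterSystem M W)

theorem T_wordProd {ω : List B} (h : cs.IsReduced ω) :
    T cs (cs.wordProd ω) = (ω.map fun i => T cs (cs.simple i)).prod := by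
  induction ω using List.reverseRecOn with
  | nil => simp [one_def]
  | append_singleton ω i ih =>
    obtain ⟨hr, hd⟩ := cs.isReduced_concat_iff.1 h
    rw [List.map_append, List.prod_append, ← ih hr, List.map_singleton, List.prod_singleton,
      T_mul_T_simple, if_neg hd, cs.wordProd_append, cs.wordProd_singleton]

theorem T_simple_mul_self (i : B) : T cs (cs.simple i) * T cs (cs.simple i) =
    qVar • 1 + (qVar - 1) • T cs (cs.simple i) := by
  rw [T_mul_T_simple, if_pos, cs.simple_mul_simple_self, one_def]
  simp [CoxeterSystem.IsRightDescent]

theorem T_simple_mul_T_simple {i j : B} (h : cs.simple i ≠ cs.simple j) :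
    T cs (cs.simple i) * T cs (cs.simple j) = T cs (cs.simple i * cs.simple j) := by
  rw [T_mul_T_simple, if_neg]
  intro hd
  rw [CoxeterSystem.IsRightDescent, cs.length_simple, Nat.lt_one_iff, cs.length_eq_zero_iff,
    mul_eq_one_iff_eq_inv, cs.inv_simple] at hd
  exact h hd

theorem commute_T_simple {i j : B} (h : M i j = 2) :
    Commute (T cs (cs.simple i)) (T cs (cs.simple j)) := by
  by_cases hs : cs.simple i = cs.simple j
  · rw [hs]
  · rw [Commute, SemiconjBy, T_simple_mul_T_simple cs hs, T_simple_mul_T_simple cs (Ne.symm hs),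
      (cs.commute_simple_of_eq_two h).eq]

/-- The inverse of `q`. -/
theorem T_neg_one_mul_qVar : (LaurentPolynomial.T (-1) : LaurentZ) * qVar = 1 := by
  rw [qVar, ← LaurentPolynomial.T_add]
  simp

/-- The element `T_s` as a unit. -/
def unitSimple (i : B) : (HeckeAlgebra cs)ˣ where
  val := T cs (cs.simple i)
  -- The quadratic relation reads `T_s (T_s - (q - 1)) = q`.
  inv := (LaurentPolynomial.T (-1) : LaurentZ) • (T cs (cs.simple i) - (qVar - 1) • 1)
  val_inv := by
    rw [mul_smul_comm, mul_sub, T_simple_mul_self, mul_smul_comm, mul_one, add_sub_cancel_right,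
      smul_smul, T_neg_one_mul_qVar, one_smul]
  inv_val := by
    rw [smul_mul_assoc, sub_mul, T_simple_mul_self, smul_mul_assoc, one_mul,
      add_sub_cancel_right, smul_smul, T_neg_one_mul_qVar, one_smul]

/-- The Hecke algebra of a right-angled Coxeter system is presented by the quadratic relations and
the commutation relations. -/
theorem exists_algHom (hM : M.IsRightAngled) {E : Type*} [Ring E] [Algebra LaurentZ E]
    (f : B → E) (hq : ∀ i, f i * f i = qVar • 1 + (qVar - 1) • f i)
    (hf : ∀ i j, M i j = 2 → Commute (f i) (f j)) :
    ∃ σ : HeckeAlgebra cs →ₐ[LaurentZ] E, ∀ i, σ (T cs (cs.simple i)) = f i := by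
  classical
  let F : HeckeAlgebra cs →ₗ[LaurentZ] E :=
    (basis cs).constr LaurentZ fun w => ((word cs w).map f).prod
  -- The word property removes the dependence on the chosen reduced word.
  have hF : ∀ ω, cs.IsReduced ω → F (T cs (cs.wordProd ω)) = (ω.map f).prod := by
    intro ω hω
    refine ((basis cs).constr_basis LaurentZ _ _).trans ?_
    exact cs.prod_map_eq_of_isReduced hM f hf (word_isReduced cs _) hω (wordProd_word cs _)
  have hF1 : F 1 = 1 := by
    have h := hF [] (by simp [CoxeterSystem.IsReduced])
    simpa [one_def] using h
  have hasc : ∀ w i, ¬ cs.IsRightDescent w i → F (T cs (w * cs.simple i)) = F (T cs w) * f i := by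
    intro w i h
    obtain ⟨ω, hω, rfl⟩ := cs.exists_isReduced w
    have h1 := hF _ (cs.isReduced_concat_iff.2 ⟨hω, h⟩)
    rw [cs.wordProd_append, cs.wordProd_singleton] at h1
    rw [h1, hF _ hω]
    simp
  have hstep : ∀ a i, F (a * T cs (cs.simple i)) = F a * f i := by
    intro a i
    have h : F ∘ₗ LinearMap.mulRight LaurentZ (T cs (cs.simple i)) =
        LinearMap.mulRight LaurentZ (f i) ∘ₗ F := by
      refine (basis cs).ext fun w => ?_
      change F (T cs w * T cs (cs.simple i)) = F (T cs w) * f i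
      rw [T_mul_T_simple]
      split_ifs with hd
      -- At a descent, `w` is the ascent of `ws` by `s`, so `F (T_w)` ends in the factor `f i` and
      -- the quadratic relation applies.
      · have hd' := cs.isRightDescent_iff_not_isRightDescent_mul.1 hd
        have h1 := hasc _ _ hd'
        rw [cs.simple_mul_simple_cancel_right] at h1
        rw [map_add, map_smul, map_smul, h1, mul_assoc, hq, mul_add, mul_smul_comm, mul_smul_comm,
          mul_one]
      · exact hasc w i hd
    exact LinearMap.congr_fun h a
  have hmul : ∀ a b, F (a * b) = F a * F b := by
    intro a b
    have h : F ∘ₗ LinearMap.mulLeft LaurentZ a = LinearMap.mulLeft LaurentZ (F a) ∘ₗ F := by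
      refine (basis cs).ext fun w => ?_
      change F (a * T cs w) = F a * F (T cs w)
      obtain ⟨ω, hω, rfl⟩ := cs.exists_isReduced w
      rw [hF _ hω, T_wordProd cs hω]
      clear hω
      induction ω using List.reverseRecOn with
      | nil => simp
      | append_singleton ω i ih =>
        rw [List.map_append, List.prod_append, List.map_append, List.prod_append,
          List.map_singleton, List.map_singleton, List.prod_singleton, List.prod_singleton,
          ← mul_assoc, hstep, ih, mul_assoc]
    exact LinearMap.congr_fun h b
  refine ⟨AlgHom.ofLinearMap F hF1 hmul, fun i => ?_⟩
  have h := hstep 1 i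
  rwa [one_mul, hF1, one_mul] at h

end HeckeAlgebra

/-! ### Right-angled Artin groups -/

namespace ArtinGroup

variable {B : Type*} {M : CoxeterMatrix B}

theorem exists_lift (hM : M.IsRightAngled) {G : Type*} [Group G] (f : B → G)
    (hf : ∀ i j, M i j = 2 → Commute (f i) (f j)) :
    ∃ φ : ArtinGroup M →* G, ∀ i, φ (gen M i) = f i := by
  have h : ∀ r ∈ {r : FreeGroup B | ∃ i j, r = M.artinRelator i j}, FreeGroup.lift f r = 1 := by
    rintro r ⟨i, j, rfl⟩
    -- The exponents `1` and `0` (that is, `∞`) give trivial relators, and `2` gives a commutator.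
    by_cases hij : i = j
    · subst hij
      simp [CoxeterMatrix.artinRelator]
    · rcases hM.eq_two_or_zero hij with h | h
      · have hc := (hf i j h).eq
        simp [CoxeterMatrix.artinRelator, h, hc]
      · simp [CoxeterMatrix.artinRelator, h]
  exact ⟨PresentedGroup.toGroup h, fun i => PresentedGroup.toGroup.of h⟩

theorem commute_gen {i j : B} (h : M i j = 2) : Commute (gen M i) (gen M j) := by
  have h1 : PresentedGroup.mk {r : FreeGroup B | ∃ i j, r = M.artinRelator i j}
      (M.artinRelator i j) = 1 := PresentedGroup.one_of_mem ⟨i, j, rfl⟩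
  rw [CoxeterMatrix.artinRelator, h] at h1
  simp only [even_two, if_true, Nat.div_self two_pos, pow_one, map_mul, map_inv,
    mul_inv_eq_one] at h1
  exact h1

theorem closure_range_gen : Subgroup.closure (Set.range (gen M)) = ⊤ :=
  PresentedGroup.closure_range_of _

/-- The element of the Artin group given by a list of powers of generators. -/
def syllableProd (L : List (B × ℤ)) : ArtinGroup M :=
  (L.map fun x => gen M x.1 ^ x.2).prod

theorem syllableProd_append (L L' : List (B × ℤ)) :
    (syllableProd (L ++ L') : ArtinGroup M) = syllableProd L * syllableProd L' := by
  simp [syllableProd]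

theorem syllableProd_cons (x : B × ℤ) (L : List (B × ℤ)) :
    (syllableProd (x :: L) : ArtinGroup M) = gen M x.1 ^ x.2 * syllableProd L := by
  simp [syllableProd]

theorem syllableProd_singleton (x : B × ℤ) :
    (syllableProd [x] : ArtinGroup M) = gen M x.1 ^ x.2 := by
  simp [syllableProd]

/-- Every element of a right-angled Artin group is a product of nonzero powers of generators along
a reduced word of the Coxeter group. -/
theorem exists_syllableProd_eq (hM : M.IsRightAngled) {W : Type*} [Group W]
    (cs : CoxeterSystem M W) (g : ArtinGroup M) :
    ∃ L : List (B × ℤ), (∀ x ∈ L, x.2 ≠ 0) ∧ cs.IsReduced (L.map Prod.fst) ∧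
      g = syllableProd L := by
  have step : ∀ (g : ArtinGroup M) (i : B) (n : ℤ),
      (∃ L : List (B × ℤ), (∀ x ∈ L, x.2 ≠ 0) ∧ cs.IsReduced (L.map Prod.fst) ∧
        g = syllableProd L) →
      ∃ L : List (B × ℤ), (∀ x ∈ L, x.2 ≠ 0) ∧ cs.IsReduced (L.map Prod.fst) ∧
        g * gen M i ^ n = syllableProd L := by
    rintro g i n ⟨L, hL, hred, rfl⟩
    -- The exponent `n = 0` is allowed because it arises when merged syllables cancel; nothing is
    -- appended then.
    have hadd : ∀ (L : List (B × ℤ)) (n : ℤ), (∀ x ∈ L, x.2 ≠ 0) → cs.IsReduced (L.map Prod.fst) →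
        ¬ cs.IsRightDescent (cs.wordProd (L.map Prod.fst)) i →
        ∃ L' : List (B × ℤ), (∀ x ∈ L', x.2 ≠ 0) ∧ cs.IsReduced (L'.map Prod.fst) ∧
        syllableProd L * gen M i ^ n = syllableProd L' := by
      intro L n hL hred hd
      by_cases hn : n = 0
      · exact ⟨L, hL, hred, by rw [hn, zpow_zero, mul_one]⟩
      · refine ⟨L ++ [(i, n)], ?_, ?_, ?_⟩
        · simp only [List.mem_append, List.mem_singleton]
          rintro x (hx | rfl)
          · exact hL x hx
          · exact hn
        · rw [List.map_append, List.map_singleton]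
          exact cs.isReduced_concat_iff.2 ⟨hred, hd⟩
        · rw [syllableProd_append, syllableProd_singleton]
    by_cases hd : cs.IsRightDescent (cs.wordProd (L.map Prod.fst)) i
    -- The syllable of `i` is taken out through letters commuting with it; `i` is no descent of what
    -- remains, and the merged power `m + n` is put at the end.
    · obtain ⟨α, β, heq, hβ⟩ := cs.exists_eq_append_of_isRightDescent hM hred hd
      obtain ⟨L₁, L₂, rfl, rfl, h₂⟩ := List.map_eq_append_iff.1 heq
      obtain ⟨⟨i', m⟩, L₃, rfl, rfl, rfl⟩ := List.map_eq_cons_iff.1 h₂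
      rw [heq] at hred
      obtain ⟨hr, -, hnd⟩ := cs.isReduced_append_and_wordProd hred hβ
      rw [← List.map_append] at hr hnd
      obtain ⟨L', h1, h2, h3⟩ := hadd (L₁ ++ L₃) (m + n)
        (fun x hx => hL x (by simp only [List.mem_append, List.mem_cons] at hx ⊢; tauto)) hr hnd
      refine ⟨L', h1, h2, ?_⟩
      have hc : Commute (gen M i' ^ m) (syllableProd L₃) := by
        refine Commute.list_prod_right _ _ fun y hy => ?_
        obtain ⟨x, hx, rfl⟩ := List.mem_map.1 hy
        exact (commute_gen (hβ _ (List.mem_map_of_mem hx))).zpow_zpow _ _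
      rw [← h3, syllableProd_append, syllableProd_append, syllableProd_cons, hc.eq, zpow_add]
      simp only [mul_assoc]
    · exact hadd L n hL hred hd
  have hg : g ∈ Subgroup.closure (Set.range (gen M)) := by
    rw [closure_range_gen]; trivial
  induction hg using Subgroup.closure_induction_right with
  | one => exact ⟨[], by simp, by simp [CoxeterSystem.IsReduced], by simp [syllableProd]⟩
  | mul_right x _ y hy ih =>
    obtain ⟨i, rfl⟩ := hy
    simpa using step x i 1 ih
  | mul_inv_cancel x _ y hy ih =>
    obtain ⟨i, rfl⟩ := hy
    simpa using step x i (-1) ih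

end ArtinGroup

/-! ### Coefficients of products of powers -/

namespace CoxeterSystem

variable {B W : Type*} [Group W] {M : CoxeterMatrix B} (cs : CoxeterSystem M W)
  {K : Type*} [Field K]

variable (K) in
/-- The basis vector of `K ⊗ V_W` given by `w`. -/
def baseVector (w : W) : K ⊗[ℤ] GroupModule W := 1 ⊗ₜ Finsupp.single w 1

variable (W K) in
/-- The coefficient of the neutral element. -/
def coeffOne : K ⊗[ℤ] GroupModule W →ₗ[K] K :=
  (TensorProduct.AlgebraTensorModule.rid ℤ K K).toLinearMap ∘ₗ
    (Finsupp.lapply (1 : W) : GroupModule W →ₗ[ℤ] ℤ).baseChange K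

open Classical in
theorem coeffOne_baseVector (w : W) :
    coeffOne W K (baseVector K w) = if w = 1 then 1 else 0 := by
  simp [coeffOne, baseVector, Finsupp.single_apply]

theorem projBaseChange_baseVector (i : B) (w : W) :
    cs.projBaseChange K i (baseVector K w) = baseVector K (cs.proj i w) := by
  rw [baseVector, projBaseChange, LinearMap.baseChange_tmul, projLin_single, baseVector]

/-- The automorphism with eigenvalue `y` on the image of the projection and `x` on its kernel. -/
def twoEigenAut (x y : Kˣ) (i : B) : (Module.End K (K ⊗[ℤ] GroupModule W))ˣ :=
  (cs.isIdempotentElem_projBaseChange K i).twoEigenUnits (x, y)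

/-- Because `twoEigenUnits` is a group morphism, powers of either sign only raise the eigenvalues to
the power `n`. -/
theorem twoEigenAut_zpow_baseVector (x y : Kˣ) (i : B) (n : ℤ) (w : W) :
    ((cs.twoEigenAut x y i ^ n : (Module.End K (K ⊗[ℤ] GroupModule W))ˣ) :
      Module.End K (K ⊗[ℤ] GroupModule W)) (baseVector K w) =
      ((x ^ n : Kˣ) : K) • baseVector K w +
        (((y ^ n : Kˣ) : K) - ((x ^ n : Kˣ) : K)) • baseVector K (cs.proj i w) := by
  rw [twoEigenAut, ← map_zpow, Prod.pow_mk, IsIdempotentElem.val_twoEigenUnits,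
    LinearMap.add_apply, LinearMap.smul_apply, LinearMap.smul_apply, LinearMap.sub_apply,
    Module.End.one_apply, projBaseChange_baseVector]
  module

variable {ρ : ArtinGroup M →* (Module.End K (K ⊗[ℤ] GroupModule W))ˣ} {x y : Kˣ}

/-- Each syllable shortens a basis element by at most one, so too few syllables cannot reach `1`. -/
theorem coeffOne_eq_zero_of_length_lt (hρ : ∀ i, ρ (ArtinGroup.gen M i) = cs.twoEigenAut x y i)
    (L : List (B × ℤ)) {w : W} (hw : L.length < cs.length w) :
    coeffOne W K ((ρ (ArtinGroup.syllableProd L)).val (baseVector K w)) = 0 := by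
  classical
  induction L using List.reverseRecOn generalizing w with
  | nil =>
    have h1 : w ≠ 1 := by
      rintro rfl
      simp at hw
    simp [ArtinGroup.syllableProd, coeffOne_baseVector, h1]
  | append_singleton L a ih =>
    rw [List.length_append, List.length_singleton] at hw
    have h := cs.length_le_length_proj a.1 w
    rw [ArtinGroup.syllableProd_append, ArtinGroup.syllableProd_singleton, map_mul, map_zpow, hρ,
      Units.val_mul, Module.End.mul_apply, twoEigenAut_zpow_baseVector, map_add, map_add,
      map_smul, map_smul, map_smul, map_smul, ih (by omega), ih (by omega), smul_zero, smul_zero,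
      add_zero]

theorem coeffOne_ne_zero (hρ : ∀ i, ρ (ArtinGroup.gen M i) = cs.twoEigenAut x y i)
    (hxy : ∀ n : ℤ, n ≠ 0 → x ^ n ≠ y ^ n)
    {L : List (B × ℤ)} (hL : ∀ a ∈ L, a.2 ≠ 0) (hr : cs.IsReduced (L.map Prod.fst)) :
    coeffOne W K ((ρ (ArtinGroup.syllableProd L)).val
      (baseVector K (cs.wordProd (L.map Prod.fst)))) ≠ 0 := by
  classical
  induction L using List.reverseRecOn with
  | nil => simp [ArtinGroup.syllableProd, coeffOne_baseVector]
  | append_singleton L a ih =>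
    have hlen := hr.eq
    rw [List.map_append, List.map_singleton] at hr
    obtain ⟨hr', hd⟩ := cs.isReduced_concat_iff.1 hr
    have hd' : cs.IsRightDescent (cs.wordProd (L.map Prod.fst) * cs.simple a.1) a.1 := by
      rw [isRightDescent_iff_not_isRightDescent_mul]
      simpa using hd
    -- The unprojected term still has length `L.length + 1`, too long for `L`; only the projected
    -- term survives, with factor `y ^ n - x ^ n`.
    have h0 := cs.coeffOne_eq_zero_of_length_lt hρ L
      (w := cs.wordProd ((L ++ [a]).map Prod.fst)) (by rw [hlen]; simp)
    rw [List.map_append, List.map_singleton, cs.wordProd_append, cs.wordProd_singleton] at h0 ⊢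
    rw [ArtinGroup.syllableProd_append, ArtinGroup.syllableProd_singleton, map_mul, map_zpow, hρ,
      Units.val_mul, Module.End.mul_apply, twoEigenAut_zpow_baseVector, map_add, map_add,
      map_smul, map_smul, map_smul, map_smul, h0, smul_zero, zero_add,
      proj_of_isRightDescent cs hd', cs.simple_mul_simple_cancel_right, smul_eq_mul]
    refine mul_ne_zero ?_ (ih (fun b hb => hL b (by simp [hb])) hr')
    rw [sub_ne_zero]
    exact fun h => hxy a.2 (hL a (by simp)) (Units.ext h.symm)

/-- A representation of a right-angled Artin group for which the generators act on the group module
with eigenvalues `x`, `y` is faithful if `x / y` is not a root of unity. -/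
theorem injective_of_gen_eq_twoEigenAut (hM : M.IsRightAngled)
    (hρ : ∀ i, ρ (ArtinGroup.gen M i) = cs.twoEigenAut x y i)
    (hxy : ∀ n : ℤ, n ≠ 0 → x ^ n ≠ y ^ n) : Function.Injective ρ := by
  classical
  rw [injective_iff_map_eq_one]
  intro g hg
  obtain ⟨L, hL, hr, rfl⟩ := ArtinGroup.exists_syllableProd_eq hM cs g
  have h := cs.coeffOne_ne_zero hρ hxy hL hr
  rw [hg, Units.val_one, Module.End.one_apply, coeffOne_baseVector] at h
  have h1 : cs.wordProd (L.map Prod.fst) = 1 := by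
    by_contra hc
    exact h (if_neg hc)
  have h2 := hr.eq
  rw [h1, cs.length_one, List.length_map] at h2
  rw [List.length_eq_zero_iff.1 h2.symm]
  simp [ArtinGroup.syllableProd]

theorem exists_rep (hM : M.IsRightAngled) (x y : Kˣ) :
    ∃ ρ : ArtinGroup M →* (Module.End K (K ⊗[ℤ] GroupModule W))ˣ,
      ∀ i, ρ (ArtinGroup.gen M i) = cs.twoEigenAut x y i :=
  ArtinGroup.exists_lift hM _ fun _ _ h => Units.ext
    (IsIdempotentElem.commute_twoEigen _ _ (cs.commute_projBaseChange K hM h) _ _).eq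

end CoxeterSystem

/-! ### Specialization -/

section Specialization

variable {B W : Type*} {M : CoxeterMatrix B} {t : ℚ} {ht : t ≠ 0}

theorem evalAt_qVar : evalAt t ht qVar = t := by
  simp [evalAt, qVar]

theorem specialize_smul (a : LaurentZ) (v : LaurentZ ⊗[ℤ] GroupModule W) :
    specialize W t ht (a • v) = evalAt t ht a • specialize W t ht v := by
  induction v using TensorProduct.induction_on with
  | zero => simp
  | tmul b v =>
    rw [TensorProduct.smul_tmul', specialize_tmul, specialize_tmul, TensorProduct.smul_tmul',
      smul_eq_mul, smul_eq_mul, map_mul]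
  | add u v hu hv => rw [smul_add, map_add, map_add, hu, hv, smul_add]

theorem IsSpecialization.of_gen
    {φ : ArtinGroup M →* (Module.End LaurentZ (LaurentZ ⊗[ℤ] GroupModule W))ˣ}
    {ρ : ArtinGroup M →* (Module.End ℚ (ℚ ⊗[ℤ] GroupModule W))ˣ}
    (h : ∀ i, IsSpecialization t ht (φ (ArtinGroup.gen M i)).val (ρ (ArtinGroup.gen M i)).val)
    (g : ArtinGroup M) : IsSpecialization t ht (φ g).val (ρ g).val := by
  have hmul : ∀ g g', IsSpecialization t ht (φ g).val (ρ g).val →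
      IsSpecialization t ht (φ g').val (ρ g').val →
      IsSpecialization t ht (φ (g * g')).val (ρ (g * g')).val := by
    intro g g' hg hg' v
    rw [map_mul, map_mul, Units.val_mul, Units.val_mul, Module.End.mul_apply,
      Module.End.mul_apply, hg', hg]
  have hinv : ∀ g, IsSpecialization t ht (φ g).val (ρ g).val →
      IsSpecialization t ht (φ g⁻¹).val (ρ g⁻¹).val := by
    intro g hg v
    have h1 : (φ g).val ((φ g⁻¹).val v) = v := by
      rw [← Module.End.mul_apply, ← Units.val_mul, ← map_mul, mul_inv_cancel, map_one,
        Units.val_one, Module.End.one_apply]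
    -- Compatibility for `g` is tested at `φ g⁻¹ v` and then solved by applying `ρ g⁻¹`.
    have h2 := hg ((φ g⁻¹).val v)
    rw [h1] at h2
    rw [← h2, ← Module.End.mul_apply, ← Units.val_mul, ← map_mul, inv_mul_cancel, map_one,
      Units.val_one, Module.End.one_apply]
  have hg : g ∈ Subgroup.closure (Set.range (ArtinGroup.gen M)) := by
    rw [ArtinGroup.closure_range_gen]; trivial
  induction hg using Subgroup.closure_induction with
  | mem x hx =>
    obtain ⟨i, rfl⟩ := hx
    exact h i
  | one =>
    intro v
    simp
  | mul x y _ _ hx hy => exact hmul x y hx hy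
  | inv x _ hx => exact hinv x hx

/-- The identity specializes only to the identity. -/
theorem IsSpecialization.eq_one {G : Module.End ℚ (ℚ ⊗[ℤ] GroupModule W)}
    (h : IsSpecialization t ht 1 G) : G = 1 := by
  refine TensorProduct.AlgebraTensorModule.ext fun a v => ?_
  have h1 := h ((1 : LaurentZ) ⊗ₜ v)
  rw [Module.End.one_apply, specialize_tmul, map_one] at h1
  have h2 : a ⊗ₜ[ℤ] v = a • ((1 : ℚ) ⊗ₜ[ℤ] v) := by
    rw [TensorProduct.smul_tmul', smul_eq_mul, mul_one]
  rw [h2, map_smul, h1, Module.End.one_apply]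

/-- Absolute values turn an equality into `|t| ^ n = 1`, which forces `t = ±1`. Thus the ratio of
the specialized eigenvalues `t` and `-1` is not a root of unity. -/
theorem zpow_ne_neg_one_zpow (h1 : t ≠ 1) (h2 : t ≠ -1) (ht : t ≠ 0) {n : ℤ} (hn : n ≠ 0) :
    (Units.mk0 t ht) ^ n ≠ (-1 : ℚˣ) ^ n := by
  intro h
  have h3 := congrArg (fun u : ℚˣ => |(u : ℚ)|) h
  simp only [Units.val_zpow_eq_zpow_val, Units.val_mk0, abs_zpow, Units.val_neg, Units.val_one,
    abs_neg, abs_one, one_zpow] at h3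
  rcases (zpow_eq_one_iff_of_ne_zero₀ hn).1 h3 with h4 | ⟨h4, -⟩
  · rcases abs_eq_abs.1 (h4.trans abs_one.symm) with h | h
    exacts [h1 h, h2 h]
  · have := abs_nonneg t
    linarith

variable [Group W] (cs : CoxeterSystem M W)

theorem specialize_projBaseChange (i : B) (v : LaurentZ ⊗[ℤ] GroupModule W) :
    specialize W t ht (cs.projBaseChange LaurentZ i v) =
      cs.projBaseChange ℚ i (specialize W t ht v) := by
  induction v using TensorProduct.induction_on with
  | zero => simp
  | tmul b v => simp [specialize_tmul]
  | add u v hu hv => rw [map_add, map_add, hu, hv, map_add, map_add]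

theorem isSpecialization_twoEigen (z : LaurentZ × LaurentZ) (i : B) :
    IsSpecialization t ht ((cs.isIdempotentElem_projBaseChange LaurentZ i).twoEigen z)
      ((cs.isIdempotentElem_projBaseChange ℚ i).twoEigen (evalAt t ht z.1, evalAt t ht z.2)) := by
  intro v
  simp only [IsIdempotentElem.twoEigen_apply, LinearMap.add_apply, LinearMap.smul_apply,
    LinearMap.sub_apply, Module.End.one_apply, map_add, map_sub, specialize_smul,
    specialize_projBaseChange]

/-- The representation of the Hecke algebra in which `T_s` has the eigenvalues `z.1`, `z.2`, and its
specializations. -/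
theorem exists_algHom_and_specialization (hM : M.IsRightAngled)
    {φ : ArtinGroup M →* (HeckeAlgebra cs)ˣ}
    (hφ : ∀ i, (φ (ArtinGroup.gen M i) : HeckeAlgebra cs) = HeckeAlgebra.T cs (cs.simple i))
    {z : LaurentZ × LaurentZ} (hz : z * z = (qVar, qVar) + (qVar - 1) • z) :
    ∃ σ : HeckeAlgebra cs →ₐ[LaurentZ] Module.End LaurentZ (LaurentZ ⊗[ℤ] GroupModule W),
      (∀ i, σ (HeckeAlgebra.T cs (cs.simple i)) =
        (cs.isIdempotentElem_projBaseChange LaurentZ i).twoEigen z) ∧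
      ∀ (t : ℚ) (ht : t ≠ 0) (x y : ℚˣ), evalAt t ht z.1 = x → evalAt t ht z.2 = y →
        (∀ n : ℤ, n ≠ 0 → x ^ n ≠ y ^ n) →
        ∃ S : ArtinGroup M →* ((ℚ ⊗[ℤ] GroupModule W) ≃ₗ[ℚ] (ℚ ⊗[ℤ] GroupModule W)),
          (∀ g : ArtinGroup M,
            IsSpecialization t ht (σ (φ g : HeckeAlgebra cs)) (S g).toLinearMap) ∧
          Function.Injective S := by
  obtain ⟨σ, hσ⟩ := HeckeAlgebra.exists_algHom cs hM
    (fun i => (cs.isIdempotentElem_projBaseChange LaurentZ i).twoEigen z)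
    -- By `hz` both eigenvalues are roots of `X² = q + (q - 1) X`, and the multiplicative `twoEigen`
    -- carries this over to the operator.
    (fun i => by
      rw [← map_mul, hz]
      simp only [IsIdempotentElem.twoEigen_apply, Prod.fst_add, Prod.snd_add, Prod.smul_fst,
        Prod.smul_snd, smul_eq_mul]
      module)
    (fun i j h => IsIdempotentElem.commute_twoEigen _ _
      (cs.commute_projBaseChange LaurentZ hM h) _ _)
  refine ⟨σ, hσ, fun t ht x y hx hy hxy => ?_⟩
  obtain ⟨ρ, hρ⟩ := cs.exists_rep hM x y
  have hspec := IsSpecialization.of_gen (t := t) (ht := ht)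
    (φ := (Units.map σ.toRingHom.toMonoidHom).comp φ) (ρ := ρ) (fun i => by
      have h := isSpecialization_twoEigen cs (t := t) (ht := ht) z i
      rw [hx, hy, ← hσ, ← hφ] at h
      rw [hρ]
      exact h)
  refine ⟨(LinearMap.GeneralLinearGroup.generalLinearEquiv ℚ _).toMonoidHom.comp ρ,
    fun g => hspec g, ?_⟩
  exact (MulEquiv.injective (LinearMap.GeneralLinearGroup.generalLinearEquiv ℚ _)).comp (cs.injective_of_gen_eq_twoEigenAut hM hρ hxy)

end Specialization

end

/-- The morphism `φ`, the representations `σ` of the Hecke algebra attached to `x = -1` and `x = q`,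
and the specialized representations `S = Σ^{x,t}` are uniquely determined by the conditions
stated before their injectivity. -/
theorem theorem4p4 {B R : Type*} [Group R] {M : CoxeterMatrix B} (cs : CoxeterSystem M R)
    (hR : M.IsRightAngled) :
    ∃ φ : ArtinGroup M →* (HeckeAlgebra cs)ˣ,
      (∀ i : B, (φ (ArtinGroup.gen M i) : HeckeAlgebra cs) = HeckeAlgebra.T cs (cs.simple i)) ∧
      Function.Injective φ ∧
      ∀ f : B → Module.End LaurentZ (LaurentZ ⊗[ℤ] GroupModule R),
        (f = repNegOne cs ∨ f = repQ cs) →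
        ∃ σ : HeckeAlgebra cs →ₐ[LaurentZ] Module.End LaurentZ (LaurentZ ⊗[ℤ] GroupModule R),
          (∀ i : B, σ (HeckeAlgebra.T cs (cs.simple i)) = f i) ∧
          ∀ (t : ℚ) (ht : t ≠ 0), t ≠ 1 → t ≠ -1 →
            ∃ S : ArtinGroup M →* ((ℚ ⊗[ℤ] GroupModule R) ≃ₗ[ℚ] (ℚ ⊗[ℤ] GroupModule R)),
              (∀ g : ArtinGroup M,
                IsSpecialization t ht (σ (φ g : HeckeAlgebra cs)) (S g).toLinearMap) ∧
              Function.Injective S := by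
  obtain ⟨φ, hφ'⟩ := ArtinGroup.exists_lift hR (HeckeAlgebra.unitSimple cs)
    fun i j h => Units.ext (HeckeAlgebra.commute_T_simple cs h).eq
  have hφ : ∀ i, (φ (ArtinGroup.gen M i) : HeckeAlgebra cs) = HeckeAlgebra.T cs (cs.simple i) :=
    fun i => by rw [hφ']; rfl
  have main : ∀ f : B → Module.End LaurentZ (LaurentZ ⊗[ℤ] GroupModule R),
      (f = repNegOne cs ∨ f = repQ cs) →
      ∃ σ : HeckeAlgebra cs →ₐ[LaurentZ] Module.End LaurentZ (LaurentZ ⊗[ℤ] GroupModule R),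
        (∀ i : B, σ (HeckeAlgebra.T cs (cs.simple i)) = f i) ∧
        ∀ (t : ℚ) (ht : t ≠ 0), t ≠ 1 → t ≠ -1 →
          ∃ S : ArtinGroup M →* ((ℚ ⊗[ℤ] GroupModule R) ≃ₗ[ℚ] (ℚ ⊗[ℤ] GroupModule R)),
            (∀ g : ArtinGroup M,
              IsSpecialization t ht (σ (φ g : HeckeAlgebra cs)) (S g).toLinearMap) ∧
            Function.Injective S := by
    rintro f (rfl | rfl)
    -- Eigenvalue `-1` on the kernel and `q` on the image: `-(1 - P) + q P = -1 + (q + 1) P`. The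
    -- other case swaps the two.
    · obtain ⟨σ, hσ, hS⟩ := exists_algHom_and_specialization cs hR hφ (z := (-1, qVar))
        (by ext1 <;> simp <;> ring)
      refine ⟨σ, fun i => ?_, fun t ht h1 h2 => hS t ht (-1) (Units.mk0 t ht) (by simp)
        evalAt_qVar fun n hn => (zpow_ne_neg_one_zpow h1 h2 ht hn).symm⟩
      rw [hσ, IsIdempotentElem.twoEigen_apply, repNegOne]
      change _ = -1 + (qVar + 1) • cs.projBaseChange LaurentZ i
      module
    · obtain ⟨σ, hσ, hS⟩ := exists_algHom_and_specialization cs hR hφ (z := (qVar, -1))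
        (by ext1 <;> simp <;> ring)
      refine ⟨σ, fun i => ?_, fun t ht h1 h2 => hS t ht (Units.mk0 t ht) (-1) evalAt_qVar
        (by simp) fun n hn => zpow_ne_neg_one_zpow h1 h2 ht hn⟩
      rw [hσ, IsIdempotentElem.twoEigen_apply, repQ]
      change _ = qVar • 1 - (qVar + 1) • cs.projBaseChange LaurentZ i
      module
  refine ⟨φ, hφ, ?_, main⟩
  -- Either representation and any admissible `t` would do. If `φ g = 1`, then `S g` specializes the
  -- identity, so `S g = 1` and `g = 1`.
  obtain ⟨σ, -, hσ⟩ := main _ (Or.inr rfl)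
  obtain ⟨S, hS, hinj⟩ := hσ 2 (by norm_num) (by norm_num) (by norm_num)
  rw [injective_iff_map_eq_one]
  intro g hg
  refine (injective_iff_map_eq_one S).1 hinj g ?_
  have h := hS g
  rw [hg, Units.val_one, map_one] at h
  exact LinearEquiv.toLinearMap_injective h.eq_one
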